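/- Let $G$ be a group with identity $e$. For subsets $E,E'\subseteq G$ write $EE'=\{xy : x\in E,\ y\in E'\}$ and, for an integer $h\ge 1$, let $E^h$ be the set of all products $a_1a_2\cdots a_h$ of exactly $h$ elements $a_i\in E$; let $\langle E\rangle$ denote the subgroup generated by $E$. A non-empty set $A\subseteq G$ is called an asymptotic approximate group if for every integer $r\ge 1$ there exist integers $l\ge 1$ and $h_0\ge 1$ such that for every integer $h\ge h_0$ there is a set $X_h\subseteq G$ with $$|X_h|\le l\qquad\text{and}\qquad A^{rh}\subseteq X_hA^h .$$ **Theorem (Sets of the form $FM$).** Let $G$ be a virtually nilpotent group, i.e. a group containing a nilpotent subgroup of finite index. Let $M\subseteq G$ be a subsemigroup (a subset closed under multiplication) with $e\in M$, and let $F\subseteq N_G(M):=\{g\in G: gMg^{-1}=M\}$ be finite and non-empty. Assume that either (i) $F$ is symmetric, i.e. $F^{-1}=F$, where $F^{-1}=\{f^{-1}:f\in F\}$; or (ii) $F$ semigroup-generates $\langle F\rangle$, i.e. $\langle F\rangle=\bigcup_{h\ge 1}F^h$. Then $A:=FM$ is an asymptotic approximate group. -/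

import Mathlib

open scoped Pointwise

/-- A non-empty set `A` in a group is an *asymptotic `(r, l)`-approximate group* if, for all
sufficiently large `h`, the product set `A ^ (r * h)` is covered by at most `l` left translates
of `A ^ h`. Here `A ^ n` is the set of products of exactly `n` elements of `A`. -/
def IsAsymptoticApproxGroupWith {G : Type*} [Group G] (r l : ℕ) (A : Set G) : Prop :=
  A.Nonempty ∧ ∃ h₀ : ℕ, 1 ≤ h₀ ∧ ∀ h : ℕ, h₀ ≤ h →
    ∃ X : Set G, X.Finite ∧ X.ncard ≤ l ∧ A ^ (r * h) ⊆ X * A ^ h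

/-- `A` is an *asymptotic approximate group* if for every `r ≥ 1` there is `l ≥ 1` such that `A`
is an asymptotic `(r, l)`-approximate group. -/
def IsAsymptoticApproxGroup {G : Type*} [Group G] (A : Set G) : Prop :=
  ∀ r : ℕ, 1 ≤ r → ∃ l : ℕ, 1 ≤ l ∧ IsAsymptoticApproxGroupWith r l A

/-- `A` *semigroup-generates* the subgroup `⟨A⟩`: every element of `⟨A⟩`, including the identity,
is a product of a positive number of elements of `A`. -/
def SemigroupGenerates {G : Type*} [Group G] (A : Set G) : Prop :=
  (Subgroup.closure A : Set G) = ⋃ h : ℕ, ⋃ _ : 1 ≤ h, A ^ h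

open scoped commutatorElement
set_option linter.unusedSectionVars false

/-! Since `F` normalizes `M`, `(FM)^n = F^n M`, so it suffices to cover `F^(rh)` by boundedly many
translates of `F^h`. For a symmetric finite `S ∋ 1` in a nilpotent group,
`exists_cover_of_isNilpotent` covers `S^(rn)` by boundedly many translates of `S^(Cn)`, where `C`
must not depend on `r`.

No growth estimate is used. An element of `S^(rn)` is a word in letters of weight 1, and a letter of
weight `w` is charged `n⁻ʷ`, so the cost is `r`. Reordering creates commutators, but
`exists_collect` keeps the cost bounded independently of `n`. A letter `τ` of weight `i` is
collected into `τ^k` with `k ≤ R n^i`. Divide `k` by `n^i`: the quotient takes boundedly many values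
and goes into the translating set; the remainder gives a power lying in `S^(Dn)` up to heavier
letters, with `D` depending only on `τ` (`exists_uniform_pow`). Thus `r` affects only the number of
translates. There are finitely many letters of each weight, and heavy letters are trivial by
nilpotency.

Schreier rewriting passes to virtually nilpotent groups, and `F⁻¹ ⊆ F^J` converts symmetric balls
into exact powers of `F`. -/

/-! ### Iterated commutators -/

/-- `IterComm S g w`: `g` is an iterated commutator of weight `w` in elements of `S`, up to
inversions at each stage. -/
inductive IterComm {N : Type*} [Group N] (S : Set N) : N → ℕ → Prop
  | gen {s : N} : s ∈ S → IterComm S s 1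
  | inv {z : N} {i : ℕ} : IterComm S z i → IterComm S z⁻¹ i
  | comm {z x : N} {i j : ℕ} : IterComm S z i → IterComm S x j → IterComm S ⁅z, x⁆ (i + j)

namespace IterComm

variable {N : Type*} [Group N] {S : Set N}

theorem one_le {g : N} {w : ℕ} (h : IterComm S g w) : 1 ≤ w := by
  induction h with
  | gen _ => exact le_rfl
  | inv _ ih => exact ih
  | comm _ _ ih _ => omega

/-- Weights are positive, so a commutator of weight `w` has strictly lighter entries, and inversion
at most doubles the set. -/
theorem finite (hS : S.Finite) (w : ℕ) : {g : N | IterComm S g w}.Finite := by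
  induction w using Nat.strong_induction_on with
  | _ w ih =>
    set C : Set N := S ∪ ⋃ i ∈ Set.Iio w, ⋃ j ∈ Set.Iio w,
      Set.image2 (fun z x => ⁅z, x⁆) {g : N | IterComm S g i} {g : N | IterComm S g j} with hC
    have hfin : C.Finite := by
      refine hS.union ?_
      refine (Set.finite_Iio w).biUnion fun i hi => (Set.finite_Iio w).biUnion fun j hj => ?_
      exact (ih i hi).image2 _ (ih j hj)
    refine (hfin.union hfin.inv).subset ?_
    have key : ∀ g v, IterComm S g v → v = w → g ∈ C ∪ C⁻¹ := by
      intro g v h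
      induction h with
      | gen hs => exact fun _ => Or.inl (Or.inl hs)
      | inv _ ih =>
        intro hv
        rcases ih hv with h | h
        · exact Or.inr (by simpa using h)
        · exact Or.inl (by simpa using h)
      | @comm z x i j hz hx _ _ =>
        intro hv
        have h1 := hz.one_le
        have h2 := hx.one_le
        refine Or.inl (Or.inr ?_)
        simp only [Set.mem_iUnion]
        exact ⟨i, Set.mem_Iio.2 (by omega), j, Set.mem_Iio.2 (by omega), z, hz, x, hx, rfl⟩
    exact fun g hg => key g w hg rfl

end IterComm

/-! ### Weighted words and the collection process -/

namespace WeightedWord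

variable {N : Type*} [Group N] {S : Set N}

/-- The product of a list of weighted letters. -/
def val (L : List (N × ℕ)) : N := (L.map Prod.fst).prod

/-- The cost of a list of weighted letters at scale `n`: a letter of weight `w` costs `n⁻ʷ`. -/
noncomputable def cost (n : ℕ) (L : List (N × ℕ)) : ℝ :=
  (L.map fun z => ((n : ℝ)⁻¹) ^ z.2).sum

/-- The commutator letter `c` with `z * x = x * z * c`. -/
def cm (z x : N × ℕ) : N × ℕ := (⁅z.1⁻¹, x.1⁻¹⁆, z.2 + x.2)

/-- The word obtained from `U` when a letter `x` on its right is moved to the left of it. -/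
def step (x : N × ℕ) (U : List (N × ℕ)) : List (N × ℕ) := U.flatMap fun z => [z, cm z x]

/-- The word obtained from `U` when the word `M` on its right is moved to the left of it. -/
def push (U M : List (N × ℕ)) : List (N × ℕ) := M.foldl (fun U x => step x U) U

@[simp] theorem val_nil : val ([] : List (N × ℕ)) = 1 := rfl
@[simp] theorem val_cons (z : N × ℕ) (L : List (N × ℕ)) : val (z :: L) = z.1 * val L := by
  simp [val]
@[simp] theorem val_append (L L' : List (N × ℕ)) : val (L ++ L') = val L * val L' := by
  simp [val]
@[simp] theorem val_replicate (k : ℕ) (z : N × ℕ) : val (List.replicate k z) = z.1 ^ k := by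
  simp [val]

@[simp] theorem cost_nil (n : ℕ) : cost n ([] : List (N × ℕ)) = 0 := rfl
@[simp] theorem cost_cons (n : ℕ) (z : N × ℕ) (L : List (N × ℕ)) :
    cost n (z :: L) = ((n : ℝ)⁻¹) ^ z.2 + cost n L := by
  simp [cost]
@[simp] theorem cost_append (n : ℕ) (L L' : List (N × ℕ)) :
    cost n (L ++ L') = cost n L + cost n L' := by
  simp [cost]
@[simp] theorem cost_replicate (n k : ℕ) (z : N × ℕ) :
    cost n (List.replicate k z) = k * ((n : ℝ)⁻¹) ^ z.2 := by
  simp [cost]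

theorem cost_nonneg (n : ℕ) (L : List (N × ℕ)) : 0 ≤ cost n L := by
  induction L with
  | nil => simp
  | cons z L ih => rw [cost_cons]; positivity

theorem step_cons (x z : N × ℕ) (U : List (N × ℕ)) :
    step x (z :: U) = z :: cm z x :: step x U := rfl
theorem step_append (x : N × ℕ) (U V : List (N × ℕ)) :
    step x (U ++ V) = step x U ++ step x V := by
  simp [step]
@[simp] theorem push_nil (U : List (N × ℕ)) : push U [] = U := rfl
theorem push_cons (U : List (N × ℕ)) (x : N × ℕ) (M : List (N × ℕ)) :
    push U (x :: M) = push (step x U) M := rfl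

theorem val_mul_step (x : N × ℕ) (U : List (N × ℕ)) : val U * x.1 = x.1 * val (step x U) := by
  induction U with
  | nil => simp [step]
  | cons z U ih =>
    rw [step_cons, val_cons, val_cons, val_cons, mul_assoc, ih]
    simp [cm, commutatorElement_def, mul_assoc]

theorem val_mul_push (U M : List (N × ℕ)) : val U * val M = val M * val (push U M) := by
  induction M generalizing U with
  | nil => simp
  | cons x M ih =>
    rw [push_cons, val_cons, mul_assoc, ← ih, ← mul_assoc, val_mul_step, mul_assoc]

/-- Weights add under commutators, so costs multiply: each letter `z` spawns one whose cost is that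
of `z` times that of `x`. -/
theorem cost_step (n : ℕ) (x : N × ℕ) (U : List (N × ℕ)) :
    cost n (step x U) = cost n U * (1 + ((n : ℝ)⁻¹) ^ x.2) := by
  induction U with
  | nil => simp [step]
  | cons z U ih =>
    rw [step_cons, cost_cons, cost_cons, cost_cons, ih]
    simp only [cm, pow_add]
    ring

/-- The factors `1 + t ≤ exp t` multiply to a bound that sees only the cost of `M`, not its length
or `n`. -/
theorem cost_push_le (n : ℕ) (U M : List (N × ℕ)) :
    cost n (push U M) ≤ cost n U * Real.exp (cost n M) := by
  induction M generalizing U with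
  | nil => simp
  | cons x M ih =>
    rw [push_cons, cost_cons, Real.exp_add]
    refine (ih _).trans ?_
    rw [cost_step, mul_assoc]
    have h1 := cost_nonneg n U
    have h2 := Real.add_one_le_exp (((n : ℝ)⁻¹) ^ x.2)
    gcongr
    linarith

/-- The words in iterated commutators of `S`. -/
def Good (S : Set N) (L : List (N × ℕ)) : Prop := ∀ z ∈ L, IterComm S z.1 z.2

theorem _root_.IterComm.cm {z x : N × ℕ} (hz : IterComm S z.1 z.2) (hx : IterComm S x.1 x.2) :
    IterComm S (cm z x).1 (cm z x).2 :=
  .comm hz.inv hx.inv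

theorem Good.step {x : N × ℕ} {U : List (N × ℕ)} (hU : Good S U) (hx : IterComm S x.1 x.2) :
    Good S (step x U) := by
  intro y hy
  simp only [WeightedWord.step, List.mem_flatMap, List.mem_cons, List.not_mem_nil, or_false] at hy
  obtain ⟨z, hz, rfl | rfl⟩ := hy
  · exact hU _ hz
  · exact (hU _ hz).cm hx

theorem Good.push {U M : List (N × ℕ)} (hU : Good S U) (hM : Good S M) : Good S (push U M) := by
  induction M generalizing U with
  | nil => exact hU
  | cons x M ih =>
    rw [push_cons]
    exact ih (hU.step (hM x (by simp))) fun z hz => hM z (by simp [hz])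

theorem Good.append {U M : List (N × ℕ)} (hU : Good S U) (hM : Good S M) : Good S (U ++ M) := by
  intro z hz
  rcases List.mem_append.1 hz with h | h
  exacts [hU z h, hM z h]

theorem le_weight_of_mem_step {x : N × ℕ} {U : List (N × ℕ)} {w : ℕ} (h : ∀ z ∈ U, w ≤ z.2) :
    ∀ y ∈ step x U, w ≤ y.2 := by
  intro y hy
  simp only [step, List.mem_flatMap, List.mem_cons, List.not_mem_nil, or_false] at hy
  obtain ⟨z, hz, rfl | rfl⟩ := hy
  · exact h _ hz
  · exact (h z hz).trans (Nat.le_add_right _ _)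

theorem le_weight_of_mem_push {U M : List (N × ℕ)} {w : ℕ} (h : ∀ z ∈ U, w ≤ z.2) :
    ∀ y ∈ push U M, w ≤ y.2 := by
  induction M generalizing U with
  | nil => exact h
  | cons x M ih => rw [push_cons]; exact ih (le_weight_of_mem_step h)

/-- Pushing a single letter `z` to the right of `M` leaves `z` followed by heavier letters. -/
theorem exists_push_singleton (z : N × ℕ) {M : List (N × ℕ)} {j : ℕ} (hM : ∀ x ∈ M, j ≤ x.2) :
    ∃ E, push [z] M = z :: E ∧ ∀ y ∈ E, z.2 + j ≤ y.2 := by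
  suffices H : ∀ V : List (N × ℕ), (∀ y ∈ V, z.2 + j ≤ y.2) →
      ∃ E, push (z :: V) M = z :: E ∧ ∀ y ∈ E, z.2 + j ≤ y.2 from H [] (by simp)
  induction M with
  | nil => exact fun V hV => ⟨V, rfl, hV⟩
  | cons x M ih =>
    intro V hV
    rw [push_cons, step_cons]
    refine ih (fun y hy => hM y (by simp [hy])) _ ?_
    intro y hy
    rcases List.mem_cons.1 hy with rfl | hy
    · exact Nat.add_le_add_left (hM x (by simp)) _
    · exact le_weight_of_mem_step hV y hy

/-- Each letter of `U` crosses `M`, leaving behind letters of weight at least `i + j`; these are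
then pushed across the rest of `U`. -/
theorem exists_commutator_word {i j n : ℕ} {U M : List (N × ℕ)} (hU : Good S U) (hM : Good S M)
    (hUi : ∀ z ∈ U, i ≤ z.2) (hMj : ∀ z ∈ M, j ≤ z.2) :
    ∃ E, val U * val M = val M * val U * val E ∧ Good S E ∧ (∀ z ∈ E, i + j ≤ z.2) ∧
      cost n E ≤ cost n U * Real.exp (cost n M) * Real.exp (cost n U) := by
  induction U with
  | nil => exact ⟨[], by simp, by simp [Good], by simp, by simp⟩
  | cons z U ih =>
    have hUg : Good S U := fun y hy => hU y (by simp [hy])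
    obtain ⟨E, hE, hEg, hEw, hEc⟩ := ih hUg fun y hy => hUi y (by simp [hy])
    obtain ⟨V, hV, hVw⟩ := exists_push_singleton z hMj
    have hzg : Good S [z] := fun y hy => hU y (by simp_all)
    have hVg : Good S V := fun y hy => hzg.push hM y (by rw [hV]; simp [hy])
    have hzi : i ≤ z.2 := hUi z (by simp)
    have hzM : z.1 * val M = val M * (z.1 * val V) := by
      have := val_mul_push [z] M
      rw [hV] at this
      simpa using this
    have hVc : cost n V ≤ ((n : ℝ)⁻¹) ^ z.2 * Real.exp (cost n M) := by
      have := cost_push_le n [z] M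
      rw [hV] at this
      simp only [cost_cons, cost_nil, add_zero] at this
      have h0 : (0 : ℝ) ≤ ((n : ℝ)⁻¹) ^ z.2 := by positivity
      linarith
    refine ⟨push V U ++ E, ?_, (hVg.push hUg).append hEg, ?_, ?_⟩
    · rw [val_append, val_cons, mul_assoc, hE, ← mul_assoc, ← mul_assoc, hzM]
      have := val_mul_push V U
      calc val M * (z.1 * val V) * val U * val E
          = val M * z.1 * (val V * val U) * val E := by group
        _ = _ := by rw [this]; group
    · intro y hy
      rcases List.mem_append.1 hy with h | h
      · exact le_weight_of_mem_push (fun y hy => (Nat.add_le_add_right hzi j).trans (hVw y hy)) y h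
      · exact hEw y h
    · rw [cost_append, cost_cons]
      have h0 : (0 : ℝ) ≤ ((n : ℝ)⁻¹) ^ z.2 := by positivity
      have h1 := cost_nonneg n U
      have h2 : Real.exp (cost n U) ≤ Real.exp (((n : ℝ)⁻¹) ^ z.2 + cost n U) := by
        apply Real.exp_le_exp.2; linarith
      calc cost n (push V U) + cost n E
          ≤ ((n : ℝ)⁻¹) ^ z.2 * Real.exp (cost n M) * Real.exp (cost n U) +
            cost n U * Real.exp (cost n M) * Real.exp (cost n U) := by
            refine add_le_add ((cost_push_le n V U).trans ?_) hEc
            gcongr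
        _ = (((n : ℝ)⁻¹) ^ z.2 + cost n U) * Real.exp (cost n M) * Real.exp (cost n U) := by ring
        _ ≤ _ := by gcongr

open Classical in
/-- All occurrences of a letter `x` in a word can be collected at its left end. -/
theorem exists_collect {n w : ℕ} (x : N × ℕ) (hx : IterComm S x.1 x.2) {W : List (N × ℕ)}
    (hW : Good S W) (hw : ∀ z ∈ W, z ≠ x → w ≤ z.2) :
    ∃ E, val W = x.1 ^ W.count x * val E ∧ Good S E ∧
      (∀ z ∈ E, (z ∈ W ∧ z ≠ x) ∨ w + x.2 ≤ z.2) ∧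
      (∀ t : N × ℕ, t ≠ x → t.2 < w + x.2 → E.count t = W.count t) ∧
      cost n E ≤ cost n W * Real.exp (W.count x * ((n : ℝ)⁻¹) ^ x.2) := by
  induction W with
  | nil => exact ⟨[], by simp, by simp [Good], by simp, by simp, by simp⟩
  | cons z W ih =>
    have hWg : Good S W := fun y hy => hW y (by simp [hy])
    obtain ⟨E, hE, hEg, hEw, hEn, hEc⟩ := ih hWg fun y hy => hw y (by simp [hy])
    by_cases hzx : z = x
    · subst hzx
      refine ⟨E, ?_, hEg, ?_, ?_, ?_⟩
      · rw [val_cons, hE, List.count_cons_self, pow_succ', mul_assoc]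
      · intro y hy
        rcases hEw y hy with h | h
        · exact Or.inl ⟨by simp [h.1], h.2⟩
        · exact Or.inr h
      · intro t ht htw
        rw [hEn t ht htw, List.count_cons_of_ne (Ne.symm ht)]
      · refine hEc.trans ?_
        rw [cost_cons, List.count_cons_self]
        have h0 : (0 : ℝ) ≤ ((n : ℝ)⁻¹) ^ z.2 := by positivity
        have h1 := cost_nonneg n W
        gcongr
        · linarith
        · omega
    · have hzw : w ≤ z.2 := hw z (by simp) hzx
      obtain ⟨V, hV, hVw⟩ := exists_push_singleton z (M := List.replicate (W.count x) x) (j := x.2)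
        (fun y hy => by rw [List.eq_of_mem_replicate hy])
      have hzg : Good S [z] := fun y hy => hW y (by simp_all)
      have hpg : Good S (z :: V) := by
        rw [← hV]
        exact hzg.push fun y hy => by rw [List.eq_of_mem_replicate hy]; exact hx
      have hzM : z.1 * x.1 ^ W.count x = x.1 ^ W.count x * (z.1 * val V) := by
        have := val_mul_push [z] (List.replicate (W.count x) x)
        rw [hV] at this
        simpa using this
      have hVc := cost_push_le n [z] (List.replicate (W.count x) x)
      rw [hV, cost_replicate, cost_cons n z [], cost_nil, add_zero] at hVc
      refine ⟨(z :: V) ++ E, ?_, hpg.append hEg, ?_, ?_, ?_⟩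
      · rw [val_cons, hE, List.count_cons_of_ne hzx, val_append, val_cons, ← mul_assoc, hzM]
        group
      · intro y hy
        rcases List.mem_append.1 hy with h | h
        · rcases List.mem_cons.1 h with rfl | h
          · exact Or.inl ⟨by simp, hzx⟩
          · exact Or.inr ((Nat.add_le_add_right hzw _).trans (hVw y h))
        · rcases hEw y h with h | h
          · exact Or.inl ⟨by simp [h.1], h.2⟩
          · exact Or.inr h
      -- Every commutator created has weight at least `w + x.2`, so lighter letters keep their
      -- multiplicities.
      · intro t ht htw
        have h0 : V.count t = 0 := List.count_eq_zero.2 fun h => by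
          have := hVw t h
          omega
        rw [List.count_append, List.count_cons, List.count_cons, h0, hEn t ht htw]
        ring
      · rw [cost_append, List.count_cons_of_ne hzx, cost_cons n z W, add_mul]
        exact add_le_add hVc hEc

open Classical in
-- Each passage of `x` creates exactly one `cm z x` per `z`; commutators with the other letters are
-- heavier. This yields the exact exponent `k * l` below.
theorem count_push_replicate (x z : N × ℕ) (hz : 1 ≤ z.2) (hx : 1 ≤ x.2) (k : ℕ)
    (U : List (N × ℕ)) (hU : ∀ y ∈ U, y = z ∨ y = cm z x ∨ z.2 + x.2 < y.2) :
    (∀ y ∈ push U (List.replicate k x), y = z ∨ y = cm z x ∨ z.2 + x.2 < y.2) ∧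
    (push U (List.replicate k x)).count z = U.count z ∧
    (push U (List.replicate k x)).count (cm z x) = U.count (cm z x) + k * U.count z := by
  have hne : z ≠ cm z x := fun h => by
    have := congrArg Prod.snd h
    simp only [cm] at this
    omega
  have hstep : ∀ U : List (N × ℕ), (∀ y ∈ U, y = z ∨ y = cm z x ∨ z.2 + x.2 < y.2) →
      (∀ y ∈ step x U, y = z ∨ y = cm z x ∨ z.2 + x.2 < y.2) ∧
      (step x U).count z = U.count z ∧
      (step x U).count (cm z x) = U.count (cm z x) + U.count z := by
    intro U hU
    induction U with
    | nil => simp [step]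
    | cons y U ih =>
      obtain ⟨h1, h2, h3⟩ := ih fun y hy => hU y (by simp [hy])
      have hy := hU y (by simp)
      have hheavy : y ≠ z → z.2 + x.2 < (cm y x).2 := by
        intro hyz
        have : z.2 + x.2 ≤ y.2 := by
          rcases hy with h | h | h
          · exact absurd h hyz
          · rw [h]; exact le_rfl
          · exact h.le
        simp only [cm]
        omega
      refine ⟨?_, ?_, ?_⟩
      · intro v hv
        rw [step_cons, List.mem_cons, List.mem_cons] at hv
        rcases hv with rfl | rfl | hv
        · exact hy
        · by_cases hyz : y = z
          · exact Or.inr (Or.inl (by rw [hyz]))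
          · exact Or.inr (Or.inr (hheavy hyz))
        · exact h1 v hv
      · have : cm y x ≠ z := fun h => by
          by_cases hyz : y = z
          · rw [hyz] at h; exact hne h.symm
          · have := hheavy hyz
            rw [h] at this
            omega
        rw [step_cons, List.count_cons, List.count_cons_of_ne this, h2, List.count_cons]
      · rw [step_cons, List.count_cons, List.count_cons, h3, List.count_cons, List.count_cons]
        by_cases hyz : y = z
        · subst hyz
          simp
          ring
        · have : cm y x ≠ cm z x := fun h => by
            have := hheavy hyz
            rw [h] at this
            simp [cm] at this
          simp [hyz, this]
          ring
  induction k generalizing U with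
  | zero => simpa using hU
  | succ k ih =>
    rw [List.replicate_succ, push_cons]
    obtain ⟨h1, h2, h3⟩ := hstep U hU
    obtain ⟨g1, g2, g3⟩ := ih _ h1
    refine ⟨g1, g2.trans h2, ?_⟩
    rw [g3, h3, h2]
    ring

/-- `z ^ l` and `x ^ k` commute up to `⁅z⁻¹, x⁻¹⁆ ^ (k * l)` and commutators of larger weight. -/
theorem exists_pow_mul_pow {z x : N} {a b n k l : ℕ} (hn : 1 ≤ n) (hz : IterComm S z b)
    (hx : IterComm S x a) (hk : k ≤ n ^ a) (hl : l ≤ n ^ b) :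
    ∃ E, z ^ l * x ^ k = x ^ k * z ^ l * ⁅z⁻¹, x⁻¹⁆ ^ (k * l) * val E ∧ Good S E ∧
      (∀ y ∈ E, a + b + 1 ≤ y.2) ∧ cost n E ≤ Real.exp 1 * Real.exp 1 * Real.exp 1 := by
  classical
  have hn' : (0 : ℝ) < n := by exact_mod_cast hn
  have hle : ∀ m c : ℕ, m ≤ n ^ c → (m : ℝ) * ((n : ℝ)⁻¹) ^ c ≤ 1 := by
    intro m c h
    rw [inv_pow, ← div_eq_mul_inv, div_le_one (by positivity)]
    exact_mod_cast h
  set X : N × ℕ := (x, a) with hX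
  set Z : N × ℕ := (z, b) with hZ
  have hb := hz.one_le
  have ha := hx.one_le
  have hZT : Z ≠ cm Z X := fun h => by
    have := congrArg Prod.snd h
    simp only [cm, hX, hZ] at this
    omega
  set U := push (List.replicate l Z) (List.replicate k X) with hUdef
  obtain ⟨h1, h2, h3⟩ := count_push_replicate X Z hb ha k (List.replicate l Z)
    (fun y hy => Or.inl (List.eq_of_mem_replicate hy))
  rw [← hUdef] at h1 h2 h3
  rw [List.count_replicate_self] at h2 h3
  rw [List.count_eq_zero.2 (fun h => hZT (List.eq_of_mem_replicate h).symm), zero_add] at h3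
  have hUg : Good S U := Good.push (fun y hy => by rw [List.eq_of_mem_replicate hy]; exact hz)
    (fun y hy => by rw [List.eq_of_mem_replicate hy]; exact hx)
  have hUc : cost n U ≤ Real.exp 1 := by
    refine (cost_push_le _ _ _).trans ?_
    rw [cost_replicate, cost_replicate]
    have e1 := hle l b hl
    have e2 := hle k a hk
    calc _ ≤ 1 * Real.exp 1 := by gcongr
      _ = _ := one_mul _
  have hUv : z ^ l * x ^ k = x ^ k * val U := by
    have := val_mul_push (List.replicate l Z) (List.replicate k X)
    simpa using this
  obtain ⟨E, hE, hEg, hEw, hEn, hEc⟩ := exists_collect (n := n) (w := a + b) Z hz hUg (by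
    intro y hy hyz
    rcases h1 y hy with h | h | h
    · exact absurd h hyz
    · rw [h]; simp only [cm, hX, hZ]; omega
    · simp only [hX, hZ] at h; omega)
  -- With `z` collected, the only remaining letter of weight `a + b` is the basic commutator;
  -- collecting it leaves weight at least `a + b + 1`.
  obtain ⟨E', hE', hEg', hEw', -, hEc'⟩ := exists_collect (n := n) (w := a + b + 1) (cm Z X)
    (IterComm.cm (z := Z) (x := X) hz hx) hEg (by
    intro y hy hyt
    rcases hEw y hy with ⟨h, hyz⟩ | h
    · rcases h1 y h with h | h | h
      · exact absurd h hyz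
      · exact absurd h hyt
      · simp only [hX, hZ] at h; omega
    · simp only [hZ] at h; omega)
  have hcnt : E.count (cm Z X) = k * l := by
    rw [hEn _ hZT.symm (by simp only [cm, hX, hZ]; omega), h3]
  rw [hcnt] at hE' hEc'
  rw [h2] at hE hEc
  refine ⟨E', ?_, hEg', ?_, ?_⟩
  · rw [hUv, hE, hE']
    simp only [cm, hX, hZ, mul_assoc]
  · intro y hy
    rcases hEw' y hy with ⟨h, hyt⟩ | h
    · rcases hEw y h with ⟨h, hyz⟩ | h
      · rcases h1 y h with h | h | h
        · exact absurd h hyz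
        · exact absurd h hyt
        · simp only [hX, hZ] at h; omega
      · simp only [hZ] at h; omega
    · omega
  · have e1 : ((l : ℕ) : ℝ) * ((n : ℝ)⁻¹) ^ Z.2 ≤ 1 := hle l b hl
    have e2 : ((k * l : ℕ) : ℝ) * ((n : ℝ)⁻¹) ^ (cm Z X).2 ≤ 1 := by
      refine hle _ _ ?_
      simp only [cm, hX, hZ]
      rw [pow_add, mul_comm]
      exact Nat.mul_le_mul hl hk
    refine hEc'.trans ?_
    gcongr
    refine hEc.trans ?_
    gcongr

end WeightedWord

/-! ### Vanishing of heavy commutators -/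

namespace IterComm

variable {N : Type*} [Group N] {S : Set N}

/-- If `i + j > 2^(d+1)`, one entry has weight above `2^d`, and bracketing it with anything gains
one term of the series. This crude bound is enough. -/
theorem mem_lowerCentralSeries {g : N} {w : ℕ} (h : IterComm S g w) :
    ∀ d, 2 ^ d < w → g ∈ (⊤ : Subgroup N).lowerCentralSeries d := by
  induction h with
  | gen _ =>
    intro d hd
    have := Nat.one_le_two_pow (n := d)
    omega
  | inv _ ih => exact fun d hd => inv_mem (ih d hd)
  | @comm z x i j _ _ ihz ihx =>
    intro d hd
    cases d with
    | zero => exact Subgroup.mem_top _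
    | succ d =>
      rw [pow_succ] at hd
      rcases lt_or_ge (2 ^ d) i with hi | hi
      · exact Subgroup.commutator_mem_commutator (ihz d hi) (Subgroup.mem_top _)
      · rw [← inv_mem_iff, commutatorElement_inv]
        exact Subgroup.commutator_mem_commutator (ihx d (by omega)) (Subgroup.mem_top _)

theorem exists_eq_one [Group.IsNilpotent N] (S : Set N) :
    ∃ c : ℕ, ∀ g w, IterComm S g w → c < w → g = 1 := by
  refine ⟨2 ^ Group.nilpotencyClass N, fun g w h hw => ?_⟩
  have := h.mem_lowerCentralSeries _ hw
  rwa [Subgroup.lowerCentralSeries_nilpotencyClass, Subgroup.mem_bot] at this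

end IterComm

/-! ### Families of bounded cost, filtered by weight -/

namespace WeightedWord

variable {N : Type*} [Group N] {S : Set N}

/-- Values of words of cost at most `R` at scale `n`, in letters of weight larger than `i` and
letters of weight `i` from `P`. -/
def words (S : Set N) (i : ℕ) (P : Set N) (n : ℕ) (R : ℝ) : Set N :=
  {g | ∃ L, val L = g ∧ Good S L ∧ (∀ z ∈ L, i < z.2 ∨ (z.2 = i ∧ z.1 ∈ P)) ∧ cost n L ≤ R}

variable {I : Type*} {ν : I → ℕ}

/-- Families which are in `words S i P` at scale `ν`, at a uniformly bounded cost. -/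
def IsBdd (S : Set N) (ν : I → ℕ) (i : ℕ) (P : Set N) (g : I → N) : Prop :=
  ∃ R : ℝ, ∀ ι, g ι ∈ words S i P (ν ι) R

theorem IsBdd.mul {i : ℕ} {P : Set N} {g h : I → N} (hg : IsBdd S ν i P g)
    (hh : IsBdd S ν i P h) : IsBdd S ν i P (g * h) := by
  obtain ⟨R, hR⟩ := hg
  obtain ⟨R', hR'⟩ := hh
  refine ⟨R + R', fun ι => ?_⟩
  obtain ⟨L, h1, h2, h3, h4⟩ := hR ι
  obtain ⟨L', h1', h2', h3', h4'⟩ := hR' ι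
  refine ⟨L ++ L', by simp [h1, h1'], h2.append h2', ?_, ?_⟩
  · intro z hz
    rcases List.mem_append.1 hz with h | h
    exacts [h3 z h, h3' z h]
  · rw [cost_append]; exact add_le_add h4 h4'

theorem IsBdd.mono {i j : ℕ} {P Q : Set N} {g : I → N} (hg : IsBdd S ν i P g)
    (h : j < i ∨ (j = i ∧ P ⊆ Q)) : IsBdd S ν j Q g := by
  obtain ⟨R, hR⟩ := hg
  refine ⟨R, fun ι => ?_⟩
  obtain ⟨L, h1, h2, h3, h4⟩ := hR ι
  refine ⟨L, h1, h2, fun z hz => ?_, h4⟩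
  rcases h with h | ⟨rfl, h⟩
  · rcases h3 z hz with h' | h'
    · exact Or.inl (h.trans h')
    · exact Or.inl (h'.1 ▸ h)
  · exact (h3 z hz).imp_right fun h' => ⟨h'.1, h h'.2⟩

theorem val_inv (L : List (N × ℕ)) :
    val (L.reverse.map fun z => (z.1⁻¹, z.2)) = (val L)⁻¹ := by
  induction L with
  | nil => simp
  | cons z L ih =>
    rw [List.reverse_cons, List.map_append, val_append, ih]
    simp

theorem cost_inv (n : ℕ) (L : List (N × ℕ)) :
    cost n (L.reverse.map fun z => (z.1⁻¹, z.2)) = cost n L := by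
  induction L with
  | nil => simp
  | cons z L ih =>
    rw [List.reverse_cons, List.map_append, cost_append, ih]
    simp [add_comm]

/-- The group of families given by words of bounded cost at scale `ν` in letters of weight at
least `i`. -/
def bdd (S : Set N) (ν : I → ℕ) (i : ℕ) : Subgroup (I → N) where
  carrier := {g | IsBdd S ν i Set.univ g}
  mul_mem' := IsBdd.mul
  one_mem' := ⟨0, fun _ => ⟨[], by simp, by simp [Good], by simp, by simp⟩⟩
  inv_mem' := by
    rintro g ⟨R, hR⟩
    refine ⟨R, fun ι => ?_⟩
    obtain ⟨L, h1, h2, h3, h4⟩ := hR ι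
    refine ⟨L.reverse.map fun z => (z.1⁻¹, z.2), by rw [val_inv, h1]; rfl, ?_, ?_, ?_⟩
    · intro z hz
      simp only [List.mem_map, List.mem_reverse] at hz
      obtain ⟨y, hy, rfl⟩ := hz
      exact (h2 y hy).inv
    · intro z hz
      simp only [List.mem_map, List.mem_reverse] at hz
      obtain ⟨y, hy, rfl⟩ := hz
      simpa using h3 y hy
    · rw [cost_inv]; exact h4

theorem mem_bdd {i : ℕ} {g : I → N} : g ∈ bdd S ν i ↔ ∃ R : ℝ, ∀ ι, ∃ L, val L = g ι ∧ Good S L ∧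
    (∀ z ∈ L, i ≤ z.2) ∧ cost (ν ι) L ≤ R := by
  simp only [bdd, ← SetLike.mem_coe, Subgroup.coe_set_mk, Submonoid.coe_set_mk,
    Subsemigroup.coe_set_mk, IsBdd, words, Set.mem_ofPred_eq, Set.mem_univ, and_true, le_iff_lt_or_eq, eq_comm]

theorem bdd_le {i j : ℕ} (h : j ≤ i) : bdd S ν i ≤ bdd S ν j := fun _ hg =>
  IsBdd.mono hg (by rcases h.lt_or_eq with h | h <;> simp [h])

theorem IsBdd.mem_bdd {i : ℕ} {P : Set N} {g : I → N} (hg : IsBdd S ν i P g) : g ∈ bdd S ν i :=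
  hg.mono (by simp)

theorem isBdd_of_mem_bdd {i : ℕ} {P : Set N} {g : I → N} (hg : g ∈ bdd S ν (i + 1)) :
    IsBdd S ν i P g :=
  IsBdd.mono (i := i + 1) (P := Set.univ) hg (Or.inl (Nat.lt_succ_self i))

/-- For families, uniform boundedness is membership in a subgroup; these subgroups form a filtration
compatible with commutators. -/
theorem commutator_mem_bdd {i j : ℕ} {u v : I → N} (hu : u ∈ bdd S ν i) (hv : v ∈ bdd S ν j) :
    ⁅u, v⁆ ∈ bdd S ν (i + j) := by
  -- The error word in swapping `u⁻¹` and `v⁻¹` is exactly `⁅u, v⁆`.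
  rw [← inv_inv u, ← inv_inv v]
  rw [← inv_mem_iff, mem_bdd] at hu hv
  obtain ⟨R, hR⟩ := hu
  obtain ⟨R', hR'⟩ := hv
  refine mem_bdd.2 ⟨R * Real.exp R' * Real.exp R, fun ι => ?_⟩
  obtain ⟨U, h1, h2, h3, h4⟩ := hR ι
  obtain ⟨V, h1', h2', h3', h4'⟩ := hR' ι
  obtain ⟨E, hE, hEg, hEw, hEc⟩ := exists_commutator_word (n := ν ι) h2 h2' h3 h3'
  refine ⟨E, ?_, hEg, hEw, hEc.trans ?_⟩
  · rw [h1, h1'] at hE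
    simp only [commutatorElement_def, Pi.mul_apply, Pi.inv_apply, inv_inv] at hE ⊢
    have : val E = ((v ι)⁻¹ * (u ι)⁻¹)⁻¹ * ((u ι)⁻¹ * (v ι)⁻¹) := by rw [hE]; group
    rw [this]; group
  · have := (cost_nonneg (ν ι) U).trans h4
    gcongr

theorem conj_mem_bdd {j : ℕ} {u v : I → N} (hu : u ∈ bdd S ν 1) (hv : v ∈ bdd S ν j) :
    u * v * u⁻¹ ∈ bdd S ν j := by
  have : u * v * u⁻¹ = ⁅u, v⁆ * v := by simp [commutatorElement_def]
  rw [this]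
  exact mul_mem (bdd_le (Nat.le_add_left _ _) (commutator_mem_bdd hu hv)) hv

theorem inv_conj_mem_bdd {j : ℕ} {u v : I → N} (hu : u ∈ bdd S ν 1) (hv : v ∈ bdd S ν j) :
    u⁻¹ * v * u ∈ bdd S ν j := by
  simpa using conj_mem_bdd (inv_mem hu) hv

/-- Families in `S ^ (C * ν)` for a constant `C`. -/
def lin {S : Set N} (hS : S⁻¹ = S) (ν : I → ℕ) : Subgroup (I → N) where
  carrier := {g | ∃ C : ℕ, ∀ ι, g ι ∈ S ^ (C * ν ι)}
  mul_mem' := by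
    rintro a b ⟨C, hC⟩ ⟨D, hD⟩
    exact ⟨C + D, fun ι => by rw [add_mul, pow_add]; exact Set.mul_mem_mul (hC ι) (hD ι)⟩
  one_mem' := ⟨0, fun ι => by simp⟩
  inv_mem' := by
    rintro a ⟨C, hC⟩
    refine ⟨C, fun ι => ?_⟩
    have := Set.inv_mem_inv.2 (hC ι)
    rwa [← inv_pow, hS] at this

theorem mem_lin {hS : S⁻¹ = S} {g : I → N} :
    g ∈ lin hS ν ↔ ∃ C : ℕ, ∀ ι, g ι ∈ S ^ (C * ν ι) := Iff.rfl

theorem exists_word_of_mem_pow {k : ℕ} {g : N} (hg : g ∈ S ^ k) :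
    ∃ L : List (N × ℕ), val L = g ∧ (∀ z ∈ L, z.1 ∈ S ∧ z.2 = 1) ∧ L.length = k := by
  induction k generalizing g with
  | zero => exact ⟨[], by simpa [eq_comm] using hg, by simp, rfl⟩
  | succ k ih =>
    rw [pow_succ'] at hg
    obtain ⟨s, hs, y, hy, rfl⟩ := Set.mem_mul.1 hg
    obtain ⟨L, hL, hLS, hLk⟩ := ih hy
    refine ⟨(s, 1) :: L, by simp [hL], ?_, by simp [hLk]⟩
    intro z hz
    rcases List.mem_cons.1 hz with rfl | h
    exacts [⟨hs, rfl⟩, hLS z h]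

theorem cost_of_weight_one {n : ℕ} {L : List (N × ℕ)} (hL : ∀ z ∈ L, z.2 = 1) :
    cost n L = L.length * (n : ℝ)⁻¹ := by
  induction L with
  | nil => simp
  | cons z L ih =>
    rw [cost_cons, ih fun y hy => hL y (by simp [hy]), hL z (by simp)]
    simp; ring

theorem isBdd_of_mem_lin {hS : S⁻¹ = S} {g : I → N} (hν : ∀ ι, 1 ≤ ν ι)
    (hg : g ∈ lin hS ν) : IsBdd S ν 1 S g := by
  obtain ⟨C, hC⟩ := hg
  refine ⟨C, fun ι => ?_⟩
  obtain ⟨L, hL, hLS, hLk⟩ := exists_word_of_mem_pow (hC ι)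
  refine ⟨L, hL, fun z hz => ?_, fun z hz => Or.inr (hLS z hz).symm, ?_⟩
  · rw [(hLS z hz).2]; exact .gen (hLS z hz).1
  · rw [cost_of_weight_one fun z hz => (hLS z hz).2, hLk]
    have : (0 : ℝ) < ν ι := by exact_mod_cast hν ι
    push_cast
    rw [mul_assoc, mul_inv_cancel₀ this.ne', mul_one]

theorem lin_le {hS : S⁻¹ = S} (hν : ∀ ι, 1 ≤ ν ι) :
    lin hS ν ≤ bdd S ν 1 := fun _ hg => (isBdd_of_mem_lin hν hg).mem_bdd

theorem pow_mem_bdd {τ : N} {i : ℕ} (hτ : IterComm S τ i) (hν : ∀ ι, 1 ≤ ν ι) {R : ℕ} {k : I → ℕ}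
    (hk : ∀ ι, k ι ≤ R * ν ι ^ i) : (fun ι => τ ^ k ι) ∈ bdd S ν i := by
  refine mem_bdd.2 ⟨R, fun ι => ⟨List.replicate (k ι) (τ, i), by simp, ?_, ?_, ?_⟩⟩
  · intro z hz; rw [List.eq_of_mem_replicate hz]; exact hτ
  · intro z hz; rw [List.eq_of_mem_replicate hz]
  · have : (0 : ℝ) < ν ι := by exact_mod_cast hν ι
    rw [cost_replicate, inv_pow, ← div_eq_mul_inv, div_le_iff₀ (by positivity)]
    exact_mod_cast hk ι

/-- Commutators of powers are powers of commutators, up to terms of larger weight. -/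
theorem exists_commutator_pow {z x : N} {a b : ℕ} {k l : I → ℕ} (hν : ∀ ι, 1 ≤ ν ι)
    (hz : IterComm S z b) (hx : IterComm S x a) (hk : ∀ ι, k ι ≤ ν ι ^ a)
    (hl : ∀ ι, l ι ≤ ν ι ^ b) :
    ∃ E ∈ bdd S ν (b + a + 1), ⁅fun ι => z ^ l ι, fun ι => x ^ k ι⁆ =
      (fun ι => ⁅z, x⁆ ^ (k ι * l ι)) * E := by
  choose E hE hEg hEw hEc using fun ι => exists_pow_mul_pow (hν ι) hz.inv hx.inv (hk ι) (hl ι)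
  refine ⟨fun ι => val (E ι), mem_bdd.2 ⟨_, fun ι => ⟨E ι, rfl, hEg ι, ?_, hEc ι⟩⟩, ?_⟩
  · intro y hy
    have := hEw ι y hy
    omega
  · funext ι
    have h := hE ι
    rw [inv_inv, inv_inv, inv_pow, inv_pow] at h
    have h2 : ⁅z, x⁆ ^ (k ι * l ι) * val (E ι) =
        ((x ^ k ι)⁻¹ * (z ^ l ι)⁻¹)⁻¹ * ((z ^ l ι)⁻¹ * (x ^ k ι)⁻¹) := by
      rw [h]; group
    simp only [Pi.mul_apply, commutatorElement_def, Pi.inv_apply] at h2 ⊢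
    rw [h2]; group

/-! ### Powers of commutators as short words -/

section linMod

variable {hS : S⁻¹ = S}

/-- The families which are in `lin` up to a bounded word in letters of weight at least `i`. -/
def linMod (hS : S⁻¹ = S) (hν : ∀ ι, 1 ≤ ν ι) (i : ℕ) : Subgroup (I → N) where
  carrier := {g | ∃ b ∈ lin hS ν, b⁻¹ * g ∈ bdd S ν i}
  mul_mem' := by
    rintro g g' ⟨b, hb, hg⟩ ⟨b', hb', hg'⟩
    refine ⟨b * b', mul_mem hb hb', ?_⟩
    have : (b * b')⁻¹ * (g * g') = (b'⁻¹ * (b⁻¹ * g) * b') * (b'⁻¹ * g') := by group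
    rw [this]
    exact mul_mem (inv_conj_mem_bdd (lin_le hν hb') hg) hg'
  one_mem' := ⟨1, one_mem _, by simp⟩
  inv_mem' := by
    rintro g ⟨b, hb, hg⟩
    refine ⟨b⁻¹, inv_mem hb, ?_⟩
    have : b⁻¹⁻¹ * g⁻¹ = b * (b⁻¹ * g)⁻¹ * b⁻¹ := by group
    rw [this]
    exact conj_mem_bdd (lin_le hν hb) (inv_mem hg)

/-- Replacing `u`, `v` by linear families changes each by an error one weight heavier, hence changes
the commutator only in weight `i + j + 1`. -/
theorem commutator_mem_linMod {hν : ∀ ι, 1 ≤ ν ι} {i j : ℕ} {u v : I → N} (hu : u ∈ linMod hS hν (i + 1)) (hv : v ∈ linMod hS hν (j + 1))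
    (hu' : u ∈ bdd S ν i) (hv' : v ∈ bdd S ν j) : ⁅u, v⁆ ∈ linMod hS hν (i + j + 1) := by
  obtain ⟨b, hb, he⟩ := hu
  obtain ⟨b', hb', he'⟩ := hv
  set e := b⁻¹ * u with hedef
  set e' := b'⁻¹ * v with hedef'
  have hu : u = b * e := by simp [hedef]
  have hv : v = b' * e' := by simp [hedef']
  have hbi : b ∈ bdd S ν i := by
    have : b = u * e⁻¹ := by simp [hu]
    rw [this]
    exact mul_mem hu' (inv_mem (bdd_le (Nat.le_succ i) he))
  have hc1 : ⁅e, v⁆ ∈ bdd S ν (i + j + 1) :=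
    bdd_le (by omega) (commutator_mem_bdd he hv')
  have hc2 : ⁅b, e'⁆ ∈ bdd S ν (i + j + 1) :=
    bdd_le (by omega) (commutator_mem_bdd hbi he')
  have hbb : ⁅b, b'⁆ ∈ lin hS ν := by
    rw [commutatorElement_def]
    exact mul_mem (mul_mem (mul_mem hb hb') (inv_mem hb)) (inv_mem hb')
  refine ⟨⁅b, b'⁆, hbb, ?_⟩
  have key : ⁅b, b'⁆⁻¹ * ⁅u, v⁆ = (⁅b, b'⁆⁻¹ * (b * ⁅e, v⁆ * b⁻¹) * ⁅b, b'⁆) *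
      (b' * ⁅b, e'⁆ * b'⁻¹) := by
    rw [hu, hv]
    simp only [commutatorElement_def]
    group
  rw [key]
  exact mul_mem (inv_conj_mem_bdd (lin_le hν hbb) (conj_mem_bdd (lin_le hν hb) hc1))
    (conj_mem_bdd (lin_le hν hb') hc2)

/-- Induction on `τ`: modulo heavier letters `⁅z, x⁆ ^ (k * l)` is `⁅z ^ l, x ^ k⁆`, so a power of
order `n^(a+b)` needs only powers of order `n^b` and `n^a`. -/
theorem pow_mem_linMod (h1 : (1 : N) ∈ S) {τ : N} {i : ℕ} (hτ : IterComm S τ i) :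
    ∀ (k : I → ℕ) (hν : ∀ ι, 1 ≤ ν ι), (∀ ι, k ι ≤ ν ι ^ i) →
      (fun ι => τ ^ k ι) ∈ linMod hS hν (i + 1) := by
  induction hτ with
  | @gen s hs =>
    intro k hν hk
    refine ⟨fun ι => s ^ k ι, ⟨1, fun ι => ?_⟩, by simp⟩
    refine Set.pow_subset_pow_right h1 ?_ (Set.pow_mem_pow hs)
    simpa using hk ι
  | @inv z i _ ih =>
    intro k hν hk
    have : (fun ι => z⁻¹ ^ k ι) = (fun ι => z ^ k ι)⁻¹ := by funext ι; simp
    rw [this]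
    exact inv_mem (ih k hν hk)
  | @comm z x b a hz hx ihz ihx =>
    intro k hν hk
    have main : ∀ k l : I → ℕ, (∀ ι, k ι ≤ ν ι ^ a) → (∀ ι, l ι ≤ ν ι ^ b) →
        (fun ι => ⁅z, x⁆ ^ (k ι * l ι)) ∈ linMod hS hν (b + a + 1) := by
      intro k l hk hl
      obtain ⟨E, hE, h⟩ := exists_commutator_pow hν hz hx hk hl
      have h' := commutator_mem_linMod (ihz l hν hl) (ihx k hν hk)
        (pow_mem_bdd (R := 1) hz hν (by simpa using hl))
        (pow_mem_bdd (R := 1) hx hν (by simpa using hk))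
      rw [h] at h'
      have hE' : E ∈ linMod hS hν (b + a + 1) := ⟨1, one_mem _, by simpa using hE⟩
      exact (Subgroup.mul_mem_cancel_right _ hE').1 h'
    have hpos : ∀ ι, 0 < ν ι ^ b := fun ι => pow_pos (hν ι) b
    -- A general exponent is split as `q * ν^b + s`, with the products `q * ν^b` and `1 * s` handled
    -- separately.
    have e1 := main (fun ι => k ι / ν ι ^ b) (fun ι => ν ι ^ b)
      (fun ι => Nat.div_le_of_le_mul (by rw [← pow_add]; exact hk ι)) fun ι => le_rfl
    have e2 := main (fun _ => 1) (fun ι => k ι % ν ι ^ b) (fun ι => Nat.one_le_pow _ _ (hν ι))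
      fun ι => (Nat.mod_lt _ (hpos ι)).le
    have := mul_mem e1 e2
    convert this using 1
    funext ι
    rw [Pi.mul_apply, ← pow_add, one_mul, mul_comm (k ι / ν ι ^ b), Nat.div_add_mod]

end linMod

end WeightedWord

/-! ### Coverings in nilpotent groups -/

namespace WeightedWord

universe u

variable {N : Type u} [Group N] {S : Set N}

open Classical in
theorem count_mul_le_cost (n : ℕ) (x : N × ℕ) (L : List (N × ℕ)) :
    L.count x * ((n : ℝ)⁻¹) ^ x.2 ≤ cost n L := by
  induction L with
  | nil => simp
  | cons z L ih =>
    rw [cost_cons, List.count_cons]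
    by_cases h : z = x
    · subst h
      simp only [beq_self_eq_true, if_true]
      push_cast
      linarith
    · have h0 : (0 : ℝ) ≤ ((n : ℝ)⁻¹) ^ z.2 := by positivity
      simp only [beq_iff_eq, h, if_false, add_zero]
      linarith

/-- Each `τ` costs `n⁻ⁱ`, so a word of cost at most `R` contains at most `R n^i` of them; collection
moves them left. -/
theorem IsBdd.exists_split {I : Type*} {ν : I → ℕ} (hν : ∀ ι, 1 ≤ ν ι) {i : ℕ} {τ : N}
    (hτ : IterComm S τ i) {P : Set N} {g : I → N} (hg : IsBdd S ν i (insert τ P) g) :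
    ∃ (R : ℕ) (k : I → ℕ) (E : I → N), (∀ ι, k ι ≤ R * ν ι ^ i) ∧
      g = (fun ι => τ ^ k ι) * E ∧ IsBdd S ν i P E := by
  classical
  obtain ⟨R, hR⟩ := hg
  choose L hL hLg hLw hLc using hR
  have hi := hτ.one_le
  choose E hE hEg hEw _ hEc using fun ι => exists_collect (n := ν ι) (w := i) (τ, i) hτ (hLg ι)
    (fun z hz _ => (hLw ι z hz).elim le_of_lt fun h => h.1.ge)
  have hcnt : ∀ ι, (L ι).count (τ, i) * ((ν ι : ℝ)⁻¹) ^ i ≤ R := fun ι =>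
    (count_mul_le_cost (ν ι) (τ, i) (L ι)).trans (hLc ι)
  refine ⟨⌈R⌉₊, fun ι => (L ι).count (τ, i), fun ι => val (E ι), fun ι => ?_, ?_,
    R * Real.exp R, fun ι => ⟨E ι, rfl, hEg ι, ?_, (hEc ι).trans ?_⟩⟩
  · have h0 : (0 : ℝ) < ν ι := by exact_mod_cast hν ι
    have h1 := hcnt ι
    rw [inv_pow, ← div_eq_mul_inv, div_le_iff₀ (by positivity)] at h1
    have h2 : ((L ι).count (τ, i) : ℝ) ≤ (⌈R⌉₊ : ℝ) * (ν ι : ℝ) ^ i :=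
      h1.trans (mul_le_mul_of_nonneg_right (Nat.le_ceil R) (by positivity))
    exact_mod_cast h2
  · funext ι
    rw [← hL ι, hE ι]
    rfl
  · intro z hz
    rcases hEw ι z hz with ⟨h, hne⟩ | h
    · refine (hLw ι z h).imp_right fun h' => ⟨h'.1, h'.2.resolve_left fun h'' => hne ?_⟩
      exact Prod.ext h'' h'.1
    · exact Or.inl (by simp only at h; omega)
  · have h0 := cost_nonneg (ν ι) (L ι)
    have h1 := hLc ι
    have h2 := hcnt ι
    have h3 := h0.trans h1
    gcongr

/-- Powers `τ ^ k` with `k ≤ n ^ i` are in `S ^ (C * n)` up to heavier letters, where the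
constant `C` depends on `τ` only. -/
theorem exists_uniform_pow (h1 : (1 : N) ∈ S) (hS : S⁻¹ = S) {τ : N} {i : ℕ}
    (hτ : IterComm S τ i) : ∃ C : ℕ, ∀ {I : Type u} (ν k : I → ℕ), (∀ ι, 1 ≤ ν ι) →
      (∀ ι, k ι ≤ ν ι ^ i) → ∃ b : I → N, (∀ ι, b ι ∈ S ^ (C * ν ι)) ∧
        b⁻¹ * (fun ι => τ ^ k ι) ∈ bdd S ν (i + 1) := by
  -- The family of all admissible pairs `(n, k)` is universal: every other family is a pullback of
  -- it, hence one constant `C` serves all.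
  obtain ⟨b, ⟨C, hC⟩, hb⟩ := pow_mem_linMod (hS := hS)
    (I := {p : ℕ × ℕ // 1 ≤ p.1 ∧ p.2 ≤ p.1 ^ i}) (ν := fun p => p.1.1) h1 hτ (fun p => p.1.2)
    (fun p => p.2.1) (fun p => p.2.2)
  refine ⟨C, fun {I} ν k hν hk => ⟨fun ι => b ⟨(ν ι, k ι), hν ι, hk ι⟩, fun ι => hC ⟨(ν ι, k ι), hν ι, hk ι⟩, ?_⟩⟩
  obtain ⟨R, hR⟩ := hb
  exact ⟨R, fun ι => hR ⟨(ν ι, k ι), hν ι, hk ι⟩⟩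

/-- Families of linear word length are covered, at each scale `n`, by boundedly many translates
of `S ^ (C * n)`, up to bounded words in letters of weight larger than `i` and letters of
weight `i` from `P`. -/
def HasCover (hS : S⁻¹ = S) (i : ℕ) (P : Set N) : Prop :=
  ∃ C : ℕ, ∀ {I : Type u} (ν : I → ℕ), (∀ ι, 1 ≤ ν ι) → ∀ g ∈ lin hS ν,
    ∃ (Q : Type) (_ : Finite Q) (X : ℕ → Q → N) (q : I → Q) (b : I → N),
      (∀ ι, b ι ∈ S ^ (C * ν ι)) ∧
        IsBdd S ν i P ((fun ι => X (ν ι) (q ι) * b ι)⁻¹ * g)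

theorem hasCover_one (hS : S⁻¹ = S) : HasCover hS 1 S :=
  ⟨0, fun _ hν g hg => ⟨Unit, inferInstance, fun _ _ => 1, fun _ => (), fun _ => 1,
    fun ι => by simp, by
      have : ((fun _ => 1 * 1)⁻¹ * g) = g := by funext ι; simp
      rw [this]
      exact isBdd_of_mem_lin hν hg⟩⟩

/-- One letter is eliminated by division with remainder: the bounded quotient enlarges the set of
translates, and the remainder adds `D`, independent of the family, to the radius constant. -/
theorem HasCover.of_insert (h1 : (1 : N) ∈ S) {hS : S⁻¹ = S} {i : ℕ} {τ : N} {P : Set N}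
    (hτ : IterComm S τ i) (h : HasCover hS i (insert τ P)) : HasCover hS i P := by
  obtain ⟨C, hC⟩ := h
  obtain ⟨D, hD⟩ := exists_uniform_pow h1 hS hτ
  refine ⟨C + D, fun ν hν g hg => ?_⟩
  obtain ⟨Q, _, X, q, b, hb, hE⟩ := hC ν hν g hg
  obtain ⟨R, k, E, hk, hgE, hEP⟩ := hE.exists_split hν hτ
  have hpos : ∀ ι, 0 < ν ι ^ i := fun ι => pow_pos (hν ι) i
  obtain ⟨b', hb', he⟩ := hD ν (fun ι => k ι % ν ι ^ i) hν fun ι => (Nat.mod_lt _ (hpos ι)).le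
  have hdiv : ∀ ι, k ι / ν ι ^ i < R + 1 := fun ι =>
    Nat.lt_succ_of_le (Nat.div_le_of_le_mul (by rw [mul_comm]; exact hk ι))
  refine ⟨Q × Fin (R + 1), inferInstance, fun n p => X n p.1 * τ ^ (n ^ i * p.2),
    fun ι => (q ι, ⟨k ι / ν ι ^ i, hdiv ι⟩), b * b', fun ι => ?_, ?_⟩
  · rw [add_mul, pow_add]
    exact Set.mul_mem_mul (hb ι) (hb' ι)
  · set T : _ → N := fun ι => τ ^ (ν ι ^ i * (k ι / ν ι ^ i)) with hT
    set t : _ → N := fun ι => τ ^ (k ι % ν ι ^ i) with ht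
    set Y : _ → N := fun ι => X (ν ι) (q ι) with hY
    have hTb : T ∈ bdd S ν i := pow_mem_bdd (R := R) hτ hν fun ι =>
      (Nat.mul_div_le _ _).trans (hk ι)
    have hTt : (fun ι => τ ^ k ι) = T * t := by
      funext ι
      rw [Pi.mul_apply, ← pow_add, Nat.div_add_mod]
    have hbl : b ∈ bdd S ν 1 := lin_le (hS := hS) hν (mem_lin.2 ⟨C, hb⟩)
    have hbl' : b' ∈ bdd S ν 1 := lin_le (hS := hS) hν (mem_lin.2 ⟨D, hb'⟩)
    -- `T` must move left past `b` to join the translate; `b` has weight 1, so the correction has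
    -- weight `i + 1`.
    have hcomm : ⁅b⁻¹, T⁻¹⁆ ∈ bdd S ν (i + 1) := by
      rw [add_comm]
      exact commutator_mem_bdd (inv_mem hbl) (inv_mem hTb)
    have key : (fun ι => Y ι * τ ^ (ν ι ^ i * (k ι / ν ι ^ i)) * (b * b') ι)⁻¹ * g =
        (b'⁻¹ * ⁅b⁻¹, T⁻¹⁆ * b') * (b'⁻¹ * t) * E := by
      have hg' : g = Y * b * (T * t * E) := by
        rw [← hTt, ← hgE]
        exact (mul_inv_cancel_left (Y * b) g).symm
      have e1 : (fun ι => Y ι * τ ^ (ν ι ^ i * (k ι / ν ι ^ i)) * (b * b') ι) =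
          Y * T * (b * b') := rfl
      rw [e1, hg', commutatorElement_def]
      group
    have := (isBdd_of_mem_bdd (P := P)
      (mul_mem (inv_conj_mem_bdd hbl' hcomm) he)).mul hEP
    rw [← key] at this
    exact this

theorem HasCover.of_finite (h1 : (1 : N) ∈ S) {hS : S⁻¹ = S} {i : ℕ} {P : Set N}
    (hP : P.Finite) (hPi : ∀ τ ∈ P, IterComm S τ i) (h : HasCover hS i P) :
    HasCover hS i ∅ := by
  induction P, hP using Set.Finite.induction_on with
  | empty => exact h
  | insert _ _ ih =>
    exact ih (fun τ hτ => hPi τ (Set.mem_insert_of_mem _ hτ))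
      (h.of_insert h1 (hPi _ (Set.mem_insert _ _)))

theorem HasCover.succ {hS : S⁻¹ = S} {i : ℕ} (h : HasCover hS i ∅) :
    HasCover hS (i + 1) {τ | IterComm S τ (i + 1)} := by
  obtain ⟨C, hC⟩ := h
  refine ⟨C, fun ν hν g hg => ?_⟩
  obtain ⟨Q, hQ, X, q, b, hb, R, hR⟩ := hC ν hν g hg
  refine ⟨Q, hQ, X, q, b, hb, R, fun ι => ?_⟩
  obtain ⟨L, h1, h2, h3, h4⟩ := hR ι
  refine ⟨L, h1, h2, fun z hz => ?_, h4⟩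
  have h5 : i < z.2 := by simpa using h3 z hz
  rcases Nat.lt_or_eq_of_le (Nat.succ_le_of_lt h5) with h6 | h6
  · exact Or.inl h6
  · refine Or.inr ⟨h6.symm, ?_⟩
    have := h2 z hz
    rwa [← h6] at this

theorem hasCover_empty (hfin : S.Finite) (h1 : (1 : N) ∈ S) (hS : S⁻¹ = S) (i : ℕ) :
    HasCover hS (i + 1) ∅ := by
  induction i with
  | zero => exact (hasCover_one hS).of_finite h1 hfin fun _ => .gen
  | succ i ih => exact ih.succ.of_finite h1 (IterComm.finite hfin _) fun _ h => h

/-- In a nilpotent group, the balls of radius `r * n` are covered by boundedly many translates of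
balls of radius `C * n`, where `C` does not depend on `r`. -/
theorem exists_cover_of_isNilpotent [Group.IsNilpotent N] (hfin : S.Finite) (h1 : (1 : N) ∈ S)
    (hS : S⁻¹ = S) : ∃ C : ℕ, ∀ r : ℕ, ∃ l : ℕ, ∀ n : ℕ, 1 ≤ n →
      ∃ X : Set N, X.Finite ∧ X.ncard ≤ l ∧ S ^ (r * n) ⊆ X * S ^ (C * n) := by
  obtain ⟨c, hc⟩ := IterComm.exists_eq_one S
  obtain ⟨C, hC⟩ := hasCover_empty hfin h1 hS c
  refine ⟨C, fun r => ?_⟩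
  -- One family runs over all scales and all elements of the balls, so `Q` bounds the number of
  -- translates for every `n`; `C` was fixed before `r`.
  obtain ⟨Q, hQ, X, q, b, hb, R, hR⟩ := hC
    (I := {p : ℕ × N // 1 ≤ p.1 ∧ p.2 ∈ S ^ (r * p.1)}) (fun p => p.1.1) (fun p => p.2.1)
    (fun p => p.1.2) (mem_lin.2 ⟨r, fun p => p.2.2⟩)
  refine ⟨Nat.card Q, fun n hn => ⟨Set.range (X n), Set.finite_range _, ?_, fun g hg => ?_⟩⟩
  · rw [← Set.image_univ, ← Set.ncard_univ]
    exact Set.ncard_image_le Set.finite_univ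
  · have h := hR ⟨(n, g), hn, hg⟩
    obtain ⟨L, hL, hLg, hLw, -⟩ := h
    have hL1 : val L = 1 := List.prod_eq_one fun y hy => by
      obtain ⟨z, hz, rfl⟩ := List.mem_map.1 hy
      exact hc _ _ (hLg z hz) (by have := hLw z hz; simp at this; omega)
    rw [hL1] at hL
    refine ⟨_, ⟨q ⟨(n, g), hn, hg⟩, rfl⟩, _, hb ⟨(n, g), hn, hg⟩, ?_⟩
    exact inv_mul_eq_one.1 hL.symm

end WeightedWord

/-! ### Passage to virtually nilpotent groups -/

section VirtuallyNilpotent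

variable {G : Type*} [Group G]

theorem Set.exists_mem_pow_of_mem_closure {S : Set G} (hS : S⁻¹ = S) {g : G}
    (hg : g ∈ Subgroup.closure S) : ∃ m, g ∈ S ^ m := by
  induction hg using Subgroup.closure_induction with
  | mem x hx => exact ⟨1, by simpa using hx⟩
  | one => exact ⟨0, by simp⟩
  | mul x y _ _ hx hy =>
    obtain ⟨a, ha⟩ := hx
    obtain ⟨b, hb⟩ := hy
    exact ⟨a + b, by rw [pow_add]; exact Set.mul_mem_mul ha hb⟩
  | inv x _ hx =>
    obtain ⟨a, ha⟩ := hx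
    refine ⟨a, ?_⟩
    have := Set.inv_mem_inv.2 ha
    rwa [← inv_pow, hS] at this

theorem Set.Finite.exists_subset_pow {S T : Set G} (h1 : (1 : G) ∈ S) (hS : S⁻¹ = S)
    (hT : T.Finite) (hTS : T ⊆ Subgroup.closure S) : ∃ m, T ⊆ S ^ m := by
  choose! f hf using fun g (hg : g ∈ T) => Set.exists_mem_pow_of_mem_closure hS (hTS hg)
  obtain ⟨m, hm⟩ := (hT.image f).bddAbove
  exact ⟨m, fun g hg => Set.pow_subset_pow_right h1 (hm (Set.mem_image_of_mem f hg)) (hf g hg)⟩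

/-- Each subgroup `K` contains a finite set of representatives of the right cosets, that meet
`K`, of a subgroup `H` of finite index. -/
theorem Subgroup.exists_finite_representatives (H K : Subgroup G) [H.FiniteIndex] :
    ∃ ρ : G → G, (Set.range ρ).Finite ∧ ∀ g ∈ K, ρ g ∈ K ∧ g * (ρ g)⁻¹ ∈ H := by
  classical
  have h : ∀ c : G ⧸ H, ∃ y : G, (∃ g ∈ K, (QuotientGroup.mk g⁻¹ : G ⧸ H) = c) →
      y ∈ K ∧ (QuotientGroup.mk y⁻¹ : G ⧸ H) = c := by
    intro c
    by_cases hc : ∃ g ∈ K, (QuotientGroup.mk g⁻¹ : G ⧸ H) = c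
    · obtain ⟨g, hg⟩ := hc
      exact ⟨g, fun _ => hg⟩
    · exact ⟨1, fun h => absurd h hc⟩
  choose y hy using h
  refine ⟨fun g => y (QuotientGroup.mk g⁻¹), ?_, fun g hg => ?_⟩
  · exact (Set.finite_range y).subset (Set.range_comp_subset_range (fun g : G => (QuotientGroup.mk g⁻¹ : G ⧸ H)) y)
  · obtain ⟨h1, h2⟩ := hy (QuotientGroup.mk g⁻¹) ⟨g, hg, rfl⟩
    refine ⟨h1, ?_⟩
    have := QuotientGroup.eq.1 h2.symm
    simpa using this

/-- In a virtually nilpotent group, the balls of radius `r * n` are covered by boundedly many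
translates of balls of radius `C * n`, where `C` does not depend on `r`. -/
theorem Group.IsVirtuallyNilpotent.exists_cover (hG : Group.IsVirtuallyNilpotent G) {S : Set G}
    (hfin : S.Finite) (h1 : (1 : G) ∈ S) (hS : S⁻¹ = S) : ∃ C : ℕ, ∀ r : ℕ, ∃ l : ℕ,
      ∀ n : ℕ, 1 ≤ n → ∃ X : Set G, X.Finite ∧ X.ncard ≤ l ∧ S ^ (r * n) ⊆ X * S ^ (C * n) := by
  obtain ⟨H, hH, hHfin⟩ := hG
  set K := Subgroup.closure S with hK
  have hSK : S ⊆ K := Subgroup.subset_closure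
  obtain ⟨ρ, hρfin, hρ⟩ := H.exists_finite_representatives K
  set Y : Set G := insert 1 (Set.range ρ ∩ K) with hY
  have hYfin : Y.Finite := (hρfin.subset Set.inter_subset_left).insert 1
  have hYK : Y ⊆ K := Set.insert_subset (one_mem K) Set.inter_subset_right
  -- Schreier generators for `K ⊓ H`.
  set U : Set G := insert 1 ((fun g => g * (ρ g)⁻¹) '' (Y * S)) with hU
  have hUK : U ⊆ (K ⊓ H : Subgroup G) := by
    refine Set.insert_subset (one_mem _) ?_
    rintro _ ⟨g, hg, rfl⟩
    have hgK : g ∈ K := by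
      obtain ⟨y, hy, s, hs, rfl⟩ := hg
      exact mul_mem (hYK hy) (hSK hs)
    exact ⟨K.mul_mem hgK (K.inv_mem (hρ g hgK).1), (hρ g hgK).2⟩
  have hUfin : U.Finite := ((hYfin.mul hfin).image _).insert 1
  set V : Set G := U ∪ U⁻¹ with hV
  have hVfin : V.Finite := hUfin.union hUfin.inv
  have hVK : V ⊆ (K ⊓ H : Subgroup G) := by
    refine Set.union_subset hUK fun g hg => ?_
    have := hUK hg
    exact (inv_mem_iff (H := K ⊓ H)).1 this
  have hcov : ∀ n, S ^ n ⊆ V ^ n * Y := by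
    intro n
    induction n with
    | zero => simp [hY]
    | succ n ih =>
      rintro _ ⟨g, hg, s, hs, rfl⟩
      obtain ⟨v, hv, y, hy, rfl⟩ := ih hg
      have hys : y * s ∈ Y * S := Set.mul_mem_mul hy hs
      have hysK : y * s ∈ K := mul_mem (hYK hy) (hSK hs)
      refine ⟨v * (y * s * (ρ (y * s))⁻¹), ?_, ρ (y * s), ?_, by simp [mul_assoc]⟩
      · rw [pow_succ]
        exact Set.mul_mem_mul hv (Or.inl (Or.inr ⟨_, hys, rfl⟩))
      · exact Or.inr ⟨⟨_, rfl⟩, (hρ _ hysK).1⟩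
  set W : Set H := (↑) ⁻¹' V with hW
  have hWV : H.subtype '' W = V := by
    ext g
    constructor
    · rintro ⟨w, hw, rfl⟩
      exact hw
    · exact fun hg => ⟨⟨g, (hVK hg).2⟩, hg, rfl⟩
  have hWfin : W.Finite := hVfin.preimage Subtype.val_injective.injOn
  have hW1 : (1 : H) ∈ W := Or.inl (Or.inl rfl)
  have hVinv : V⁻¹ = V := by rw [hV, Set.union_inv, inv_inv, Set.union_comm]
  have hWinv : W⁻¹ = W := by
    ext w
    have : (w⁻¹ : G) ∈ V ↔ (w : G) ∈ V := by rw [← Set.mem_inv, hVinv]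
    simpa [hW] using this
  have hWpow : ∀ n, H.subtype '' (W ^ n) = V ^ n := fun n => by rw [Set.image_pow, hWV]
  -- Returning from `V` and `Y` to `S` costs a fixed factor `m`, independent of `r`.
  obtain ⟨m, hm⟩ := (hVfin.union hYfin).exists_subset_pow h1 hS
    (Set.union_subset (fun g hg => (hVK hg).1) hYK)
  obtain ⟨hmV, hmY⟩ := Set.union_subset_iff.1 hm
  obtain ⟨C, hC⟩ := WeightedWord.exists_cover_of_isNilpotent hWfin hW1 hWinv
  refine ⟨m * C + m, fun r => ?_⟩
  obtain ⟨l, hl⟩ := hC r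
  refine ⟨l, fun n hn => ?_⟩
  obtain ⟨X, hXfin, hXl, hX⟩ := hl n hn
  refine ⟨H.subtype '' X, hXfin.image _, (Set.ncard_image_le hXfin).trans hXl, ?_⟩
  calc S ^ (r * n) ⊆ V ^ (r * n) * Y := hcov _
    _ = H.subtype '' (W ^ (r * n)) * Y := by rw [hWpow]
    _ ⊆ H.subtype '' (X * W ^ (C * n)) * Y := Set.mul_subset_mul_right (Set.image_mono hX)
    _ = H.subtype '' X * (V ^ (C * n) * Y) := by rw [Set.image_mul, hWpow, mul_assoc]
    _ ⊆ H.subtype '' X * ((S ^ m) ^ (C * n) * S ^ (m * n)) := by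
        refine Set.mul_subset_mul_left (Set.mul_subset_mul (Set.pow_subset_pow_left hmV) ?_)
        exact hmY.trans (Set.pow_subset_pow_right h1 (Nat.le_mul_of_pos_right m hn))
    _ = H.subtype '' X * S ^ ((m * C + m) * n) := by
        rw [← pow_mul, ← pow_add]
        congr 2
        ring

/-! ### From symmetric balls to exact powers of `F` -/

/-- A finite set that semigroup-generates a subgroup, or is symmetric, has its inverses in one
of its powers. -/
theorem exists_inv_subset_pow {F : Set G} (hFfin : F.Finite)
    (hF : F⁻¹ = F ∨ SemigroupGenerates F) : ∃ J, 1 ≤ J ∧ F⁻¹ ⊆ F ^ J := by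
  rcases hF with hF | hF
  · exact ⟨1, le_rfl, by simp [hF]⟩
  have h : ∀ f ∈ F, ∃ j, 1 ≤ j ∧ f⁻¹ ∈ F ^ j := by
    intro f hf
    have : f⁻¹ ∈ (Subgroup.closure F : Set G) := inv_mem (Subgroup.subset_closure hf)
    rw [hF] at this
    simpa using this
  choose! j hj1 hj using h
  -- `1 ∈ F^(1 + j f)`, so any common multiple `L` of these lengths gives `f⁻¹ ∈ F^(L - 1)` for all
  -- `f` at once; the factor 2 makes `L - 1` positive.
  set L := 2 * ∏ f ∈ hFfin.toFinset, (1 + j f) with hL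
  have hLpos : 0 < ∏ f ∈ hFfin.toFinset, (1 + j f) := Finset.prod_pos fun f _ => by omega
  refine ⟨L - 1, by omega, fun g hg => ?_⟩
  have hf : g⁻¹ ∈ F := hg
  have hgj := hj _ hf
  rw [inv_inv] at hgj
  obtain ⟨c, hc⟩ : 1 + j g⁻¹ ∣ L :=
    (Finset.dvd_prod_of_mem (fun f => 1 + j f) (hFfin.mem_toFinset.2 hf)).mul_left 2
  have h1 : (1 : G) ∈ F ^ (1 + j g⁻¹) := by
    rw [pow_add, pow_one]
    exact ⟨g⁻¹, hf, g, hgj, by simp⟩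
  have hcpos : c ≠ 0 := by
    rintro rfl
    simp at hc
    omega
  obtain ⟨d, rfl⟩ := Nat.exists_eq_succ_of_ne_zero hcpos
  have h2 : L - 1 = j g⁻¹ + (1 + j g⁻¹) * d := by
    rw [hc, Nat.mul_succ]
    omega
  rw [h2, pow_add, pow_mul]
  exact ⟨g, hgj, 1, by simpa using Set.pow_mem_pow (n := d) h1, by simp⟩

/-- Finite sets whose inverses lie in one of their powers are asymptotic approximate groups in
virtually nilpotent groups. -/
theorem exists_cover_pow_of_inv_subset (hG : Group.IsVirtuallyNilpotent G) {F : Set G}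
    (hFfin : F.Finite) (hFne : F.Nonempty) {J : ℕ} (hJ : 1 ≤ J) (hFJ : F⁻¹ ⊆ F ^ J) (r : ℕ) :
    ∃ l h₀ : ℕ, 1 ≤ h₀ ∧ ∀ h, h₀ ≤ h → ∃ X : Set G, X.Finite ∧ X.ncard ≤ l ∧
      F ^ (r * h) ⊆ X * F ^ h := by
  obtain ⟨f, hf⟩ := hFne
  set T := F ^ (J + 1) with hT
  have hT1 : (1 : G) ∈ T := by
    rw [hT, pow_succ']
    exact ⟨f, hf, f⁻¹, hFJ (Set.inv_mem_inv.2 hf), by simp⟩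
  have hTinv : T⁻¹ ⊆ T ^ J := by
    rw [hT, ← inv_pow, ← pow_mul, mul_comm, pow_mul]
    exact Set.pow_subset_pow_left hFJ
  have hpowfin : ∀ k, (F ^ k).Finite := fun k => by
    induction k with
    | zero => exact Set.finite_one
    | succ k ih => rw [pow_succ]; exact ih.mul hFfin
  set S := T ∪ T⁻¹ with hS
  have hS1 : (1 : G) ∈ S := Or.inl hT1
  have hSinv : S⁻¹ = S := by rw [hS, Set.union_inv, inv_inv, Set.union_comm]
  have hST : S ⊆ T ^ J := Set.union_subset
    (by simpa using Set.pow_subset_pow_right hT1 hJ) hTinv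
  obtain ⟨C, hC⟩ := hG.exists_cover ((hpowfin _).union (hpowfin _).inv) hS1 hSinv
  -- Chosen so that `S^((C + 1) * n)`, and hence `S^(C * n)`, lies in `F^(m * n)`; `C + 1` keeps `m`
  -- positive.
  set m := (J + 1) * J * (C + 1) with hm
  have hmpos : 0 < m := by positivity
  -- `h ≤ 2 * m * n` for `n = h / m ≥ 1`. The radius depends on `C` through `m`, so `C` has to be
  -- independent of the radius.
  obtain ⟨l, hl⟩ := hC (r * (2 * m))
  refine ⟨l, m, hmpos, fun h hh => ?_⟩
  obtain ⟨X, hXfin, hXl, hX⟩ := hl (h / m) (Nat.div_pos hh hmpos)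
  set n := h / m with hn
  set s := h % m with hs
  have hh' : h = s + m * n := by rw [add_comm]; exact (Nat.div_add_mod h m).symm
  have hnpos : 1 ≤ n := Nat.div_pos hh hmpos
  have hhn : h ≤ 2 * m * n := by
    have : s < m := Nat.mod_lt _ hmpos
    nlinarith
  have hball : S ^ (C * n) ⊆ F ^ (m * n) := by
    calc S ^ (C * n) ⊆ S ^ ((C + 1) * n) :=
          Set.pow_subset_pow_right hS1 (Nat.mul_le_mul_right _ (Nat.le_succ C))
      _ ⊆ (T ^ J) ^ ((C + 1) * n) := Set.pow_subset_pow_left hST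
      _ = F ^ (m * n) := by
          rw [hT, ← pow_mul, ← pow_mul]
          congr 1
          rw [hm]; ring
  -- `F` need not contain 1, so lengths are exact: `f ^ (r * h * J)` pads `g` to a product of `r *
  -- h` elements of `T`, and `f ^ s` supplies the remainder of `h` modulo `m`.
  refine ⟨(fun x => (f ^ (r * h * J))⁻¹ * x * (f ^ s)⁻¹) '' X, hXfin.image _,
    (Set.ncard_image_le hXfin).trans hXl, fun g hg => ?_⟩
  have hg1 : f ^ (r * h * J) * g ∈ T ^ (r * h) := by
    rw [hT, ← pow_mul, show (J + 1) * (r * h) = r * h * J + r * h by ring, pow_add]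
    exact Set.mul_mem_mul (Set.pow_mem_pow hf) hg
  have hg2 : f ^ (r * h * J) * g ∈ S ^ (r * (2 * m) * n) := by
    refine Set.pow_subset_pow_right hS1 ?_
      (Set.pow_subset_pow_left (Set.subset_union_left (t := T⁻¹)) hg1)
    rw [mul_assoc]
    exact Nat.mul_le_mul_left r hhn
  obtain ⟨x, hx, b, hb, hxb⟩ := hX hg2
  refine ⟨_, ⟨x, hx, rfl⟩, f ^ s * b, ?_, ?_⟩
  · rw [hh', pow_add]
    exact Set.mul_mem_mul (Set.pow_mem_pow hf) (hball hb)
  · have : g = (f ^ (r * h * J))⁻¹ * (x * b) := by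
      rw [eq_inv_mul_iff_mul_eq]; exact hxb.symm
    rw [this]
    group

theorem Subsemigroup.coe_pow_eq (M : Subsemigroup G) (hM : (1 : G) ∈ M) {n : ℕ} (hn : 1 ≤ n) :
    (M : Set G) ^ n = M := by
  induction n, hn using Nat.le_induction with
  | base => simp
  | succ n _ ih =>
    rw [pow_succ, ih]
    refine Set.Subset.antisymm ?_ fun g hg => ⟨g, hg, 1, hM, by simp⟩
    rintro _ ⟨a, ha, b, hb, rfl⟩
    exact mul_mem (S := Subsemigroup G) ha hb

theorem Set.commute_of_subset_normalizer {F M : Set G}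
    (hFM : F ⊆ (Subgroup.normalizer M : Set G)) : Commute F M := by
  have hiff : ∀ f ∈ F, ∀ x, x ∈ M ↔ f * x * f⁻¹ ∈ M := fun f hf =>
    Subgroup.mem_set_normalizer_iff.1 (hFM hf)
  refine Set.Subset.antisymm ?_ ?_
  · rintro _ ⟨f, hf, x, hx, rfl⟩
    exact ⟨f * x * f⁻¹, (hiff f hf x).1 hx, f, hf, by simp⟩
  · rintro _ ⟨x, hx, f, hf, rfl⟩
    exact ⟨f, hf, f⁻¹ * x * f, (hiff f hf _).2 (by simpa [mul_assoc] using hx), by simp [mul_assoc]⟩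

end VirtuallyNilpotent

/-! ### Sets of the form `FM` -/

theorem mainTheorem3 {G : Type*} [Group G] (hG : Group.IsVirtuallyNilpotent G)
    (M : Subsemigroup G) (hM : (1 : G) ∈ M)
    (F : Set G) (hFfin : F.Finite) (hFne : F.Nonempty)
    (hFM : F ⊆ (Subgroup.normalizer (M : Set G) : Set G))
    (hF : F⁻¹ = F ∨ SemigroupGenerates F) :
    IsAsymptoticApproxGroup (F * (M : Set G)) := by
  intro r hr
  obtain ⟨J, hJ, hFJ⟩ := exists_inv_subset_pow hFfin hF
  obtain ⟨l, h₀, hh₀, hl⟩ := exists_cover_pow_of_inv_subset hG hFfin hFne hJ hFJ r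
  have hpow : ∀ n, 1 ≤ n → (F * (M : Set G)) ^ n = F ^ n * M := fun n hn => by
    rw [(Set.commute_of_subset_normalizer hFM).mul_pow, M.coe_pow_eq hM hn]
  -- The maximum enforces the required positive bound.
  refine ⟨max 1 l, le_max_left _ _, hFne.mul ⟨1, hM⟩, h₀, hh₀, fun h hh => ?_⟩
  obtain ⟨X, hXfin, hXl, hX⟩ := hl h hh
  refine ⟨X, hXfin, hXl.trans (le_max_right _ _), ?_⟩
  have h1 : 1 ≤ h := hh₀.trans hh
  rw [hpow _ (Nat.mul_pos hr h1), hpow _ h1, ← mul_assoc]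
  exact Set.mul_subset_mul_right hX
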